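/- Write points of $\mathbb{R}^{n+1}=\mathbb{R}^n\times\mathbb{R}$ as $(x,t)$, let $e_{n+1}=(0,\dots,0,1)$, and let $B^n_1=\{x\in\mathbb{R}^n:\sum_{k}|x^k|\le 1\}$, $B^n_\infty=\{x\in\mathbb{R}^n:\max_k|x^k|\le 1\}$. For $n\ge 1$ put $$W^{(2)}_n=\operatorname{conv}\Big(\big(\tfrac{n}{e}B^n_1\big)\times\{0\}\ \cup\ B^n_\infty\times\{1\}\Big)\subset\mathbb{R}^{n+1}.$$ For a convex body $K\subset\mathbb{R}^{d}$ (a compact convex set with nonempty interior) let $l(K)$ be the center of its Löwner ellipsoid, that is, of the unique ellipsoid of minimal volume containing $K$, and let $g(K)=\frac{1}{\operatorname{vol}_d(K)}\int_K x\,dx$ be its centroid. Then, for every $n\ge 1$, $W^{(2)}_n$ is a convex body; its minimal-volume circumscribed ellipsoids exist and all have the same center $l(W^{(2)}_n)$; and $$l(W^{(2)}_n)=l_n\,e_{n+1},\qquad g(W^{(2)}_n)=g_n\,e_{n+1}$$ for real numbers $l_n,g_n$ which satisfy, as $n\to\infty$, $$l_n=\frac1n+o\Big(\frac1n\Big),\qquad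 g_n=1-\frac1e-\frac1n\Big(1-\frac2e\Big)+o\Big(\frac1n\Big).$$ -/

import Mathlib

open scoped Pointwise

noncomputable section

/-- A convex body: a compact convex set with nonempty interior. -/
def IsSolidConvexBody {d : ℕ} (K : Set (EuclideanSpace ℝ (Fin d))) : Prop :=
  Convex ℝ K ∧ IsCompact K ∧ (interior K).Nonempty

/-- `E` is a (nondegenerate) ellipsoid with center `c`: the image of the closed Euclidean unit ball
under an invertible affine map `x ↦ c + A x`. -/
def IsEllipsoid {d : ℕ} (E : Set (EuclideanSpace ℝ (Fin d))) (c : EuclideanSpace ℝ (Fin d)) :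
    Prop :=
  ∃ A : EuclideanSpace ℝ (Fin d) ≃L[ℝ] EuclideanSpace ℝ (Fin d),
    E = (fun x => c + A x) '' Metric.closedBall 0 1

/-- `E`, an ellipsoid with center `c`, has minimal volume among all ellipsoids containing `K`. -/
def IsLownerEllipsoid {d : ℕ} (K E : Set (EuclideanSpace ℝ (Fin d)))
    (c : EuclideanSpace ℝ (Fin d)) : Prop :=
  IsEllipsoid E c ∧ K ⊆ E ∧
    ∀ (E' : Set (EuclideanSpace ℝ (Fin d))) (c' : EuclideanSpace ℝ (Fin d)),
      IsEllipsoid E' c' → K ⊆ E' → MeasureTheory.volume E ≤ MeasureTheory.volume E'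

/-- `p` is the center of a Löwner (minimal volume circumscribed) ellipsoid of `K`. -/
def IsLownerCenter {d : ℕ} (K : Set (EuclideanSpace ℝ (Fin d))) (p : EuclideanSpace ℝ (Fin d)) :
    Prop :=
  ∃ E : Set (EuclideanSpace ℝ (Fin d)), IsLownerEllipsoid K E p

/-- The centroid `(1 / vol K) ∫_K x dx`. -/
def bodyCentroid {d : ℕ} (K : Set (EuclideanSpace ℝ (Fin d))) : EuclideanSpace ℝ (Fin d) :=
  (MeasureTheory.volume.real K)⁻¹ • ∫ x in K, x

/-- The octahedron `B_1^n`. -/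
def octahedron (n : ℕ) : Set (EuclideanSpace ℝ (Fin n)) := {x | ∑ k, |x k| ≤ 1}

/-- The cube `B_∞^n`. -/
def cube (n : ℕ) : Set (EuclideanSpace ℝ (Fin n)) := {x | ∀ k, |x k| ≤ 1}

/-- The point `(x, t)` of `ℝⁿ × ℝ = ℝⁿ⁺¹`, with `t` as last coordinate. -/
def atHeight {n : ℕ} (t : ℝ) (x : EuclideanSpace ℝ (Fin n)) : EuclideanSpace ℝ (Fin (n + 1)) :=
  WithLp.toLp 2 (Fin.snoc (α := fun _ => ℝ) (fun i => x i) t)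

/-- The body `W_n^{(2)} = conv(((n/e) B_1^n, 0), (B_∞^n, 1))` in `ℝⁿ⁺¹`. -/
def bodyW2 (n : ℕ) : Set (EuclideanSpace ℝ (Fin (n + 1))) :=
  convexHull ℝ
    (atHeight 0 '' (((n : ℝ) / Real.exp 1) • octahedron n) ∪ atHeight 1 '' cube n)

/-- The last standard basis vector `e_{n+1}` of `ℝⁿ⁺¹`. -/
def lastBasisVector (n : ℕ) : EuclideanSpace ℝ (Fin (n + 1)) :=
  EuclideanSpace.single (Fin.last n) 1

end

/-! Put r = n/e. The centre of the Löwner ellipsoid is found by a duality certificate in the style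
of John. An ellipsoid containing the body has the form ‖Mv - w‖ ≤ 1. Averaging this constraint over
suitable vertices, with weight 1 - c on the bottom octahedron and c on the top cube, gives a trace
inequality (`trace_bound_of_bodyW2_subset`). Hadamard's inequality and z ≤ exp(z - 1) turn it into
an upper bound for det M² carrying the factor exp(-(n+1)‖w - c M e_{n+1}‖²)
(`det_sq_le_of_bodyW2_subset`). If c solves a certain quadratic equation, an ellipsoid of revolution
centred at c e_{n+1} contains the body and attains the bound, so it is minimal. The exponential
factor forces every other minimal ellipsoid to have the same centre (`isLownerCenter_bodyW2_iff`).
The root c gives l_n ~ 1/n.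

For the centroid, the slice at height t is r(1-t)B_1 + tB_∞, whose volume is an explicit polynomial
(`volume_crossCubeSum`). Beta integrals express the volume and the first moment through the
truncated exponential series S = ∑_{k≤n} r^k/k!. Hence g_n = (n + 1 - r + d_n)/(n + 2) with d_n =
r(r^n/n!)/S, and Stirling's lower bound for n! gives d_n → 0. -/

/-! ### The body as a set of inequalities. -/

lemma atHeight_castSucc {n : ℕ} (t : ℝ) (x : EuclideanSpace ℝ (Fin n)) (k : Fin n) :
    atHeight t x k.castSucc = x k := by
  simp [atHeight]

lemma atHeight_last {n : ℕ} (t : ℝ) (x : EuclideanSpace ℝ (Fin n)) :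
    atHeight t x (Fin.last n) = t := by
  simp [atHeight]

lemma mem_smul_octahedron {n : ℕ} {r : ℝ} (hr : 0 < r) (x : EuclideanSpace ℝ (Fin n)) :
    x ∈ r • octahedron n ↔ ∑ k, |x k| ≤ r := by
  rw [Set.mem_smul_set_iff_inv_smul_mem₀ hr.ne']
  simp only [octahedron, Set.mem_ofPred_eq, PiLp.smul_apply, smul_eq_mul, abs_mul, abs_inv,
    abs_of_pos hr, ← Finset.mul_sum]
  rw [inv_mul_le_iff₀ hr, mul_one]

/-- The facet description of the convex hull of `r B₁ × {0}` and `B_∞ × {1}`. -/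
def cubeConeRegion (n : ℕ) (r : ℝ) : Set (EuclideanSpace ℝ (Fin (n + 1))) :=
  {v | 0 ≤ v (Fin.last n) ∧ v (Fin.last n) ≤ 1 ∧
    ∑ k : Fin n, max (|v k.castSucc| - v (Fin.last n)) 0 ≤ r * (1 - v (Fin.last n))}

lemma convex_cubeConeRegion (n : ℕ) (r : ℝ) : Convex ℝ (cubeConeRegion n r) := by
  intro v hv w hw a b ha hb hab
  obtain ⟨h1, h2, h3⟩ := hv
  obtain ⟨k1, k2, k3⟩ := hw
  refine ⟨?_, ?_, ?_⟩
  · simp only [PiLp.add_apply, PiLp.smul_apply, smul_eq_mul]; positivity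
  · simp only [PiLp.add_apply, PiLp.smul_apply, smul_eq_mul]; nlinarith
  · simp only [PiLp.add_apply, PiLp.smul_apply, smul_eq_mul]
    calc _ ≤ ∑ k : Fin n, (a * max (|v k.castSucc| - v (Fin.last n)) 0 +
          b * max (|w k.castSucc| - w (Fin.last n)) 0) := by
          refine Finset.sum_le_sum fun k _ => max_le ?_ (by positivity)
          have e1 := abs_add_le (a * v k.castSucc) (b * w k.castSucc)
          rw [abs_mul, abs_mul, abs_of_nonneg ha, abs_of_nonneg hb] at e1
          have e2 := mul_le_mul_of_nonneg_left (le_max_left (|v k.castSucc| - v (Fin.last n)) 0) ha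
          have e3 := mul_le_mul_of_nonneg_left (le_max_left (|w k.castSucc| - w (Fin.last n)) 0) hb
          linarith
      _ ≤ a * (r * (1 - v (Fin.last n))) + b * (r * (1 - w (Fin.last n))) := by
          rw [Finset.sum_add_distrib, ← Finset.mul_sum, ← Finset.mul_sum]
          gcongr
      _ = r * (a + b - (a * v (Fin.last n) + b * w (Fin.last n))) := by ring
      _ = _ := by rw [hab]

lemma radius_pos {n : ℕ} (hn : 1 ≤ n) : 0 < (n : ℝ) / Real.exp 1 := by
  have : (0 : ℝ) < n := by exact_mod_cast hn
  positivity

lemma bodyW2_eq_cubeConeRegion {n : ℕ} (hn : 1 ≤ n) :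
    bodyW2 n = cubeConeRegion n (n / Real.exp 1) := by
  have hr := radius_pos hn
  set r := (n : ℝ) / Real.exp 1 with hrdef
  apply Set.Subset.antisymm
  · refine convexHull_min ?_ (convex_cubeConeRegion n r)
    rintro _ (⟨x, hx, rfl⟩ | ⟨x, hx, rfl⟩)
    · rw [mem_smul_octahedron hr] at hx
      simp only [cubeConeRegion, Set.mem_ofPred_eq, atHeight_last, atHeight_castSucc]
      simpa using hx
    · simp only [cubeConeRegion, Set.mem_ofPred_eq, atHeight_last, atHeight_castSucc]
      refine ⟨zero_le_one, le_rfl, ?_⟩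
      rw [Finset.sum_eq_zero]
      · simp
      · intro k _
        exact max_eq_right (by have := hx k; linarith)
  · rintro v ⟨h0, h1, hs⟩
    set t := v (Fin.last n) with ht
    have hclamp : ∀ x : ℝ, |max (-t) (min x t)| ≤ t ∧
        |x - max (-t) (min x t)| = max (|x| - t) 0 := by
      intro x
      rcases le_total x t with h | h <;> rcases le_total (-t) x with h' | h'
      · have : max (-t) (min x t) = x := by rw [min_eq_left h, max_eq_right h']
        rw [this, sub_self, abs_zero, max_eq_right (by rw [sub_nonpos, abs_le]; exact ⟨h', h⟩)]
        exact ⟨abs_le.2 ⟨h', h⟩, rfl⟩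
      · have : max (-t) (min x t) = -t := by rw [min_eq_left h, max_eq_left h']
        rw [this, abs_neg, abs_of_nonneg h0, abs_of_nonpos (by linarith : x - -t ≤ 0),
          abs_of_nonpos (by linarith : x ≤ 0), max_eq_left (by linarith)]
        exact ⟨le_rfl, by ring⟩
      · have : max (-t) (min x t) = t := by rw [min_eq_right h, max_eq_right (by linarith)]
        rw [this, abs_of_nonneg h0, abs_of_nonneg (by linarith : 0 ≤ x - t),
          abs_of_nonneg (by linarith : 0 ≤ x), max_eq_left (by linarith)]
        exact ⟨le_rfl, rfl⟩
      · have : max (-t) (min x t) = t := by rw [min_eq_right h, max_eq_right (by linarith)]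
        rw [this, abs_of_nonneg h0, abs_of_nonneg (by linarith : 0 ≤ x - t),
          abs_of_nonneg (by linarith : 0 ≤ x), max_eq_left (by linarith)]
        exact ⟨le_rfl, rfl⟩
    -- Clamping each coordinate to [-t, t] leaves the cube part z; the excess y has the ℓ¹ norm
    -- bounded in `cubeConeRegion`.
    let z : Fin n → ℝ := fun k => max (-t) (min (v k.castSucc) t)
    let y : Fin n → ℝ := fun k => v k.castSucc - z k
    have hy : ∑ k, |y k| ≤ r * (1 - t) := by
      refine le_of_eq_of_le (Finset.sum_congr rfl fun k _ => (hclamp _).2) hs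
    have hz : ∀ k, |z k| ≤ t := fun k => (hclamp _).1
    -- At t = 1 the inverse is 0 by convention and the point is the origin, which is harmless
    -- because then y = 0. The same happens for z at t = 0.
    have hy' : WithLp.toLp 2 (fun k => (1 - t)⁻¹ * y k) ∈ r • octahedron n := by
      rw [mem_smul_octahedron hr]
      simp only [abs_mul, ← Finset.mul_sum, abs_inv, abs_of_nonneg (sub_nonneg.2 h1)]
      rcases eq_or_lt_of_le h1 with h | h
      · rw [h]; simpa using hr.le
      · rw [inv_mul_le_iff₀ (by linarith)]; linarith
    have hz' : WithLp.toLp 2 (fun k => t⁻¹ * z k) ∈ cube n := by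
      intro k
      simp only [abs_mul, abs_inv, abs_of_nonneg h0]
      rcases eq_or_lt_of_le h0 with h | h
      · rw [← h]; simp
      · rw [inv_mul_le_iff₀ h]; linarith [hz k]
    have key : v = (1 - t) • atHeight 0 (WithLp.toLp 2 (fun k => (1 - t)⁻¹ * y k)) +
        t • atHeight 1 (WithLp.toLp 2 (fun k => t⁻¹ * z k)) := by
      ext i
      refine Fin.lastCases ?_ (fun k => ?_) i
      · simp only [PiLp.add_apply, PiLp.smul_apply, smul_eq_mul, atHeight_last]
        rw [← ht]; ring
      · simp only [PiLp.add_apply, PiLp.smul_apply, smul_eq_mul, atHeight_castSucc]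
        have e1 : (1 - t) * ((1 - t)⁻¹ * y k) = y k := by
          rcases eq_or_ne (1 - t) 0 with h | h
          · have : |y k| ≤ 0 := by
              refine le_trans (Finset.single_le_sum (f := fun k => |y k|)
                (fun i _ => abs_nonneg _) (Finset.mem_univ k)) (hy.trans ?_)
              rw [h, mul_zero]
            rw [h, abs_nonpos_iff.1 this]; simp
          · rw [mul_inv_cancel_left₀ h]
        have e2 : t * (t⁻¹ * z k) = z k := by
          rcases eq_or_ne t 0 with h | h
          · have : |z k| ≤ 0 := (hz k).trans h.le
            rw [abs_nonpos_iff.1 this]; simp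
          · rw [mul_inv_cancel_left₀ h]
        rw [e1, e2]; simp [y]
    rw [key]
    have hW : Convex ℝ (bodyW2 n) := convex_convexHull ℝ _
    refine hW (x := atHeight 0 _) ?_ (y := atHeight 1 _) ?_ (sub_nonneg.2 h1) h0
      (sub_add_cancel 1 t)
    · exact subset_convexHull ℝ _ (Or.inl ⟨_, hy', rfl⟩)
    · exact subset_convexHull ℝ _ (Or.inr ⟨_, hz', rfl⟩)

lemma isClosed_cubeConeRegion (n : ℕ) (r : ℝ) : IsClosed (cubeConeRegion n r) := by
  have h1 : IsClosed {v : EuclideanSpace ℝ (Fin (n + 1)) | 0 ≤ v (Fin.last n)} :=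
    isClosed_le (by fun_prop) (by fun_prop)
  have h2 : IsClosed {v : EuclideanSpace ℝ (Fin (n + 1)) | v (Fin.last n) ≤ 1} :=
    isClosed_le (by fun_prop) (by fun_prop)
  have h3 : IsClosed {v : EuclideanSpace ℝ (Fin (n + 1)) |
      ∑ k : Fin n, max (|v k.castSucc| - v (Fin.last n)) 0 ≤ r * (1 - v (Fin.last n))} :=
    isClosed_le (by fun_prop) (by fun_prop)
  exact h1.inter (h2.inter h3)

lemma interior_cubeConeRegion_nonempty (n : ℕ) {r : ℝ} (hr : 0 < r) :
    (interior (cubeConeRegion n r)).Nonempty := by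
  let U : Set (EuclideanSpace ℝ (Fin (n + 1))) :=
    {v | 0 < v (Fin.last n)} ∩ ({v | v (Fin.last n) < 1} ∩
      ⋂ k : Fin n, {v | |v k.castSucc| < v (Fin.last n)})
  have hU : IsOpen U :=
    (isOpen_lt (by fun_prop) (by fun_prop)).inter ((isOpen_lt (by fun_prop) (by fun_prop)).inter
      (isOpen_iInter_of_finite fun k => isOpen_lt (by fun_prop) (by fun_prop)))
  have hUK : U ⊆ cubeConeRegion n r := by
    rintro v ⟨h0, h1, hk⟩
    simp only [Set.mem_iInter, Set.mem_ofPred_eq] at h0 h1 hk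
    refine ⟨h0.le, h1.le, ?_⟩
    rw [Finset.sum_eq_zero fun k _ => max_eq_right (by linarith [hk k])]
    have : 0 ≤ 1 - v (Fin.last n) := by linarith
    positivity
  refine ⟨atHeight (1 / 2) 0, interior_maximal hUK hU ?_⟩
  simp only [U, Set.mem_inter_iff, Set.mem_iInter, Set.mem_ofPred_eq, atHeight_last,
    atHeight_castSucc]
  norm_num

/-! ### Determinant bound for containing ellipsoids. -/

/-- The Hadamard inequality for the determinant of an endomorphism. -/
lemma abs_linearMap_det_le_prod_norm {d : ℕ}
    (M : EuclideanSpace ℝ (Fin d) →ₗ[ℝ] EuclideanSpace ℝ (Fin d)) :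
    |LinearMap.det M| ≤ ∏ i, ‖M (EuclideanSpace.single i 1)‖ := by
  have : Fact (Module.finrank ℝ (EuclideanSpace ℝ (Fin d)) = d) := ⟨by simp⟩
  let b := EuclideanSpace.basisFun (Fin d) ℝ
  let o := b.toBasis.orientation
  have h := o.abs_volumeForm_apply_le (fun i => M (b i))
  rw [o.volumeForm_robust b rfl] at h
  have h2 : b.toBasis.det (fun i => M (b i)) = LinearMap.det M := by
    have := b.toBasis.det_comp M b.toBasis
    rw [Module.Basis.det_self, mul_one] at this
    rw [← this]
    congr 1
  rw [h2] at h
  simpa [b] using h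

lemma exists_sign_norm_sq_add_le {E : Type*} [NormedAddCommGroup E] [InnerProductSpace ℝ E]
    (u m : E) : ∃ ε : ℝ, |ε| = 1 ∧ ‖m‖ ^ 2 + ‖u‖ ^ 2 ≤ ‖ε • m + u‖ ^ 2 := by
  rcases le_total 0 (inner ℝ m u) with h | h
  · refine ⟨1, by simp, ?_⟩
    rw [one_smul, norm_add_sq_real]; linarith
  · refine ⟨-1, by simp, ?_⟩
    rw [neg_one_smul, norm_add_sq_real, inner_neg_left, norm_neg]; linarith

/-- The left side is the mean of the right side over all sign vectors. Instead of averaging, the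
signs are chosen one at a time, each making its cross term nonnegative. -/
lemma exists_signs_norm_sq_sum_le {E : Type*} [NormedAddCommGroup E] [InnerProductSpace ℝ E] :
    ∀ (n : ℕ) (m : Fin n → E) (u : E), ∃ ε : Fin n → ℝ, (∀ k, |ε k| = 1) ∧
      ∑ k, ‖m k‖ ^ 2 + ‖u‖ ^ 2 ≤ ‖∑ k, ε k • m k + u‖ ^ 2
  | 0, m, u => ⟨fun _ => 1, by simp, by simp⟩
  | n + 1, m, u => by
      obtain ⟨δ, hδ, h1⟩ := exists_sign_norm_sq_add_le u (m 0)
      obtain ⟨ε, hε, h2⟩ := exists_signs_norm_sq_sum_le n (fun k => m k.succ) (δ • m 0 + u)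
      refine ⟨Fin.cons δ ε, fun k => ?_, ?_⟩
      · refine Fin.cases ?_ (fun k => ?_) k
        · simpa using hδ
        · simpa using hε k
      · rw [Fin.sum_univ_succ, Fin.sum_univ_succ]
        simp only [Fin.cons_zero, Fin.cons_succ]
        rw [add_comm (δ • m 0), add_assoc _ (δ • m 0)]
        linarith

lemma atHeight_eq_sum {n : ℕ} (t : ℝ) (x : EuclideanSpace ℝ (Fin n)) :
    atHeight t x = ∑ k : Fin n, x k • EuclideanSpace.single k.castSucc (1 : ℝ) +
      t • lastBasisVector n := by
  ext i
  refine Fin.lastCases ?_ (fun j => ?_) i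
  · simp [atHeight_last, lastBasisVector, Finset.sum_apply]
  · simp [atHeight_castSucc, lastBasisVector, Finset.sum_apply, Pi.single_apply]

lemma atHeight_single_zero_mem {n : ℕ} (hn : 1 ≤ n) (j : Fin n) {ε : ℝ} (hε : |ε| = 1) :
    atHeight 0 (EuclideanSpace.single j (ε * ((n : ℝ) / Real.exp 1))) ∈ bodyW2 n := by
  have hr := radius_pos hn
  refine subset_convexHull ℝ _ (Or.inl ⟨_, ?_, rfl⟩)
  rw [mem_smul_octahedron hr, Finset.sum_eq_single j]
  · simp [abs_mul, hε, abs_of_pos hr]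
  · intro i _ hi; simp [hi]
  · simp

lemma atHeight_signs_one_mem {n : ℕ} {ε : Fin n → ℝ} (hε : ∀ k, |ε k| = 1) :
    atHeight 1 (WithLp.toLp 2 ε) ∈ bodyW2 n :=
  subset_convexHull ℝ _ (Or.inr ⟨_, fun k => (hε k).le, rfl⟩)

/-- The averaged constraint which a containing ellipsoid satisfies. -/
lemma trace_bound_of_bodyW2_subset {n : ℕ} (hn : 1 ≤ n)
    (M : EuclideanSpace ℝ (Fin (n + 1)) →ₗ[ℝ] EuclideanSpace ℝ (Fin (n + 1)))
    (w : EuclideanSpace ℝ (Fin (n + 1))) (h : ∀ v ∈ bodyW2 n, ‖M v - w‖ ≤ 1)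
    {c : ℝ} (hc0 : 0 ≤ c) (hc1 : c ≤ 1) :
    (∑ k : Fin n, ‖M (EuclideanSpace.single k.castSucc 1)‖ ^ 2) *
        ((1 - c) * (n / Real.exp 1 ^ 2) + c) +
      c * (1 - c) * ‖M (lastBasisVector n)‖ ^ 2 + ‖w - c • M (lastBasisVector n)‖ ^ 2 ≤ 1 := by
  have hr := radius_pos hn
  have hn0 : (0 : ℝ) < n := by exact_mod_cast hn
  set m : Fin n → EuclideanSpace ℝ (Fin (n + 1)) :=
    fun k => M (EuclideanSpace.single k.castSucc 1) with hm
  set T := M (lastBasisVector n) with hT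
  set r := (n : ℝ) / Real.exp 1 with hrd
  have hM : ∀ t (x : EuclideanSpace ℝ (Fin n)), M (atHeight t x) = ∑ k, x k • m k + t • T := by
    intro t x
    rw [atHeight_eq_sum]
    simp [hm, hT]
  have hsq : ∀ v ∈ bodyW2 n, ‖M v - w‖ ^ 2 ≤ 1 := fun v hv =>
    pow_le_one₀ (norm_nonneg _) (h v hv)
  have hb : ∀ j, r ^ 2 * ‖m j‖ ^ 2 + ‖w‖ ^ 2 ≤ 1 := by
    intro j
    obtain ⟨ε, hε, h1⟩ := exists_sign_norm_sq_add_le (-w) (r • m j)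
    have h2 := hsq _ (atHeight_single_zero_mem hn j hε)
    rw [hM, Finset.sum_eq_single j (by intro i _ hi; simp [hi]) (by simp)] at h2
    rw [norm_smul, norm_neg, mul_pow, Real.norm_of_nonneg hr.le, smul_smul] at h1
    simp only [PiLp.single_apply, if_true, zero_smul, add_zero, sub_eq_add_neg] at h2
    exact h1.trans h2
  have hbsum : r ^ 2 * ∑ j, ‖m j‖ ^ 2 + n * ‖w‖ ^ 2 ≤ n := by
    have := Finset.sum_le_sum fun j (_ : j ∈ Finset.univ) => hb j
    rw [Finset.sum_add_distrib, ← Finset.mul_sum] at this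
    simpa using this
  have htop : ∑ j, ‖m j‖ ^ 2 + ‖T - w‖ ^ 2 ≤ 1 := by
    obtain ⟨ε, hε, h1⟩ := exists_signs_norm_sq_sum_le n m (T - w)
    have h2 := hsq _ (atHeight_signs_one_mem hε)
    rw [hM, one_smul, add_sub_assoc] at h2
    exact h1.trans h2
  have e1 : ‖T - w‖ ^ 2 = ‖T‖ ^ 2 - 2 * inner ℝ T w + ‖w‖ ^ 2 := norm_sub_sq_real _ _
  have e2 : ‖w - c • T‖ ^ 2 = ‖w‖ ^ 2 - 2 * (c * inner ℝ T w) + c ^ 2 * ‖T‖ ^ 2 := by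
    rw [norm_sub_sq_real, inner_smul_right, real_inner_comm, norm_smul, mul_pow,
      Real.norm_eq_abs, sq_abs]
  have e3 : r ^ 2 = n * (n / Real.exp 1 ^ 2) := by rw [hrd]; ring
  have hbsum' : (n / Real.exp 1 ^ 2) * ∑ j, ‖m j‖ ^ 2 + ‖w‖ ^ 2 ≤ 1 := by
    rw [e3, mul_assoc, ← mul_add] at hbsum
    nlinarith
  -- The weighted sum closes by (1-c)‖w‖² + c‖T - w‖² = c(1-c)‖T‖² + ‖w - cT‖².
  have f1 := mul_le_mul_of_nonneg_left hbsum' (sub_nonneg.2 hc1)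
  have f2 := mul_le_mul_of_nonneg_left htop hc0
  rw [e1] at f2
  rw [e2]
  nlinarith

/-- Squared inverse semi-axes of an ellipsoid of revolution about the last coordinate axis. -/
def revolutionWeight (n : ℕ) (α β : ℝ) : Fin (n + 1) → ℝ :=
  Fin.snoc (α := fun _ => ℝ) (fun _ => α) β

lemma prod_revolutionWeight (n : ℕ) (α β : ℝ) :
    ∏ i, revolutionWeight n α β i = α ^ n * β := by
  simp [revolutionWeight, Fin.prod_univ_castSucc]

/-- The normalisation of α and β makes n + 1 times the trace bound read (∑ m k)/α + T/β + (n+1)δ ≤ n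
+ 1. Applying z ≤ exp(z - 1) to each m k/α and to T/β, and multiplying, is AM-GM with the defect δ
retained. -/
lemma det_sq_le_of_bodyW2_subset {n : ℕ} (hn : 1 ≤ n)
    (M : EuclideanSpace ℝ (Fin (n + 1)) →ₗ[ℝ] EuclideanSpace ℝ (Fin (n + 1)))
    (w : EuclideanSpace ℝ (Fin (n + 1))) (h : ∀ v ∈ bodyW2 n, ‖M v - w‖ ≤ 1)
    {c α β : ℝ} (hc0 : 0 ≤ c) (hc1 : c ≤ 1) (hα : 0 < α) (hβ : 0 < β)
    (hαc : α * ((n + 1) * ((1 - c) * (n / Real.exp 1 ^ 2) + c)) = 1)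
    (hβc : β * ((n + 1) * (c * (1 - c))) = 1) :
    LinearMap.det M ^ 2 ≤
      α ^ n * β * Real.exp (-((n + 1) * ‖w - c • M (lastBasisVector n)‖ ^ 2)) := by
  have hb := trace_bound_of_bodyW2_subset hn M w h hc0 hc1
  have hd := abs_linearMap_det_le_prod_norm M
  set m : Fin n → ℝ := fun k => ‖M (EuclideanSpace.single k.castSucc 1)‖ ^ 2 with hm
  set T := ‖M (lastBasisVector n)‖ ^ 2 with hT
  set δ := ‖w - c • M (lastBasisVector n)‖ ^ 2
  have h1 : LinearMap.det M ^ 2 ≤ (∏ k, m k) * T := by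
    rw [← sq_abs]
    refine (pow_le_pow_left₀ (abs_nonneg _) hd 2).trans_eq ?_
    rw [Fin.prod_univ_castSucc, mul_pow, ← Finset.prod_pow]
    rfl
  have hz : ∀ z : ℝ, z ≤ Real.exp (z - 1) := fun z => by linarith [Real.add_one_le_exp (z - 1)]
  have h2 : (∏ k, m k / α) * (T / β) ≤ Real.exp (-((n + 1) * δ)) := by
    calc (∏ k, m k / α) * (T / β) ≤ (∏ k, Real.exp (m k / α - 1)) * Real.exp (T / β - 1) := by
          refine mul_le_mul (Finset.prod_le_prod (fun k _ => by positivity) fun k _ => hz _) (hz _)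
            (by positivity) (Finset.prod_nonneg fun k _ => (Real.exp_pos _).le)
      _ = Real.exp ((∑ k, m k) / α - n + (T / β - 1)) := by
          rw [← Real.exp_sum, ← Real.exp_add, Finset.sum_sub_distrib, Finset.sum_div]
          simp
      _ ≤ _ := by
          rw [Real.exp_le_exp]
          have ea : (∑ k, m k) / α = (∑ k, m k) * ((n + 1) * ((1 - c) * (n / Real.exp 1 ^ 2) + c)) := by
            rw [div_eq_iff hα.ne', mul_assoc, mul_comm _ α, hαc, mul_one]
          have eb : T / β = T * ((n + 1) * (c * (1 - c))) := by
            rw [div_eq_iff hβ.ne', mul_assoc, mul_comm _ β, hβc, mul_one]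
          rw [ea, eb]
          have := mul_le_mul_of_nonneg_left hb (by positivity : (0 : ℝ) ≤ n + 1)
          linarith
  have h3 : (∏ k, m k) * T = α ^ n * β * ((∏ k, m k / α) * (T / β)) := by
    rw [Finset.prod_div_distrib]
    simp only [Finset.prod_const, Finset.card_univ, Fintype.card_fin]
    field_simp
  rw [h3] at h1
  exact h1.trans (mul_le_mul_of_nonneg_left h2 (by positivity))

/-! ### Ellipsoids of revolution and optimality. -/

lemma volume_ellipsoid {d : ℕ} (A : EuclideanSpace ℝ (Fin d) ≃L[ℝ] EuclideanSpace ℝ (Fin d))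
    (c : EuclideanSpace ℝ (Fin d)) :
    MeasureTheory.volume ((fun x => c + A x) '' Metric.closedBall 0 1) =
      ENNReal.ofReal |LinearMap.det (A : EuclideanSpace ℝ (Fin d) →ₗ[ℝ] EuclideanSpace ℝ (Fin d))| *
        MeasureTheory.volume (Metric.closedBall (0 : EuclideanSpace ℝ (Fin d)) 1) := by
  rw [← MeasureTheory.Measure.addHaar_image_continuousLinearEquiv,
    ← MeasureTheory.measure_preimage_add MeasureTheory.volume c
      ((fun x => c + A x) '' Metric.closedBall 0 1)]
  congr 1
  ext y
  simp

lemma volume_ellipsoid_le_iff {d : ℕ}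
    (A B : EuclideanSpace ℝ (Fin d) ≃L[ℝ] EuclideanSpace ℝ (Fin d))
    (a b : EuclideanSpace ℝ (Fin d)) :
    MeasureTheory.volume ((fun x => a + A x) '' Metric.closedBall 0 1) ≤
        MeasureTheory.volume ((fun x => b + B x) '' Metric.closedBall 0 1) ↔
      LinearMap.det (A : EuclideanSpace ℝ (Fin d) →ₗ[ℝ] EuclideanSpace ℝ (Fin d)) ^ 2 ≤
        LinearMap.det (B : EuclideanSpace ℝ (Fin d) →ₗ[ℝ] EuclideanSpace ℝ (Fin d)) ^ 2 := by
  rw [volume_ellipsoid, volume_ellipsoid, ENNReal.mul_le_mul_iff_left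
    (Metric.measure_closedBall_pos _ _ one_pos).ne' MeasureTheory.measure_closedBall_lt_top.ne,
    ENNReal.ofReal_le_ofReal_iff (abs_nonneg _), sq_le_sq]

/-- Coordinatewise scaling by nonzero factors. -/
noncomputable def coordScaling {d : ℕ} (a : Fin d → ℝ) (ha : ∀ i, a i ≠ 0) :
    EuclideanSpace ℝ (Fin d) ≃L[ℝ] EuclideanSpace ℝ (Fin d) :=
  LinearEquiv.toContinuousLinearEquiv
    { toFun := fun v => WithLp.toLp 2 (fun i => a i * v i)
      invFun := fun v => WithLp.toLp 2 (fun i => (a i)⁻¹ * v i)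
      map_add' := fun v w => by ext i; simp [mul_add]
      map_smul' := fun r v => by ext i; simp; ring
      left_inv := fun v => by ext i; simp [ha i]
      right_inv := fun v => by ext i; simp [ha i] }

lemma coordScaling_apply {d : ℕ} (a : Fin d → ℝ) (ha : ∀ i, a i ≠ 0)
    (v : EuclideanSpace ℝ (Fin d)) (i : Fin d) : coordScaling a ha v i = a i * v i := rfl

lemma coordScaling_symm_apply {d : ℕ} (a : Fin d → ℝ) (ha : ∀ i, a i ≠ 0)
    (v : EuclideanSpace ℝ (Fin d)) (i : Fin d) :
    (coordScaling a ha).symm v i = (a i)⁻¹ * v i := rfl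

lemma det_coordScaling {d : ℕ} (a : Fin d → ℝ) (ha : ∀ i, a i ≠ 0) :
    LinearMap.det (coordScaling a ha :
      EuclideanSpace ℝ (Fin d) →ₗ[ℝ] EuclideanSpace ℝ (Fin d)) = ∏ i, a i := by
  rw [← LinearMap.det_toMatrix (EuclideanSpace.basisFun (Fin d) ℝ).toBasis,
    ← Matrix.det_diagonal]
  congr 1
  ext i j
  rw [LinearMap.toMatrix_apply]
  by_cases hij : i = j
  · subst hij
    simp [coordScaling_apply]
  · simp [coordScaling_apply, hij]

lemma mem_ellipsoid_iff {d : ℕ} (A : EuclideanSpace ℝ (Fin d) ≃L[ℝ] EuclideanSpace ℝ (Fin d))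
    (c v : EuclideanSpace ℝ (Fin d)) :
    v ∈ (fun x => c + A x) '' Metric.closedBall 0 1 ↔ ‖A.symm (v - c)‖ ≤ 1 := by
  constructor
  · rintro ⟨x, hx, rfl⟩
    simpa using hx
  · intro h
    exact ⟨A.symm (v - c), by simpa using h, by simp⟩

lemma convex_ellipsoid {d : ℕ} (A : EuclideanSpace ℝ (Fin d) ≃L[ℝ] EuclideanSpace ℝ (Fin d))
    (c : EuclideanSpace ℝ (Fin d)) : Convex ℝ ((fun x => c + A x) '' Metric.closedBall 0 1) := by
  have : (fun x => c + A x) '' Metric.closedBall 0 1 =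
      (fun x => c + x) '' (A '' Metric.closedBall 0 1) := by rw [Set.image_image]
  rw [this]
  exact ((convex_closedBall 0 1).linear_image
    (A : EuclideanSpace ℝ (Fin d) →ₗ[ℝ] EuclideanSpace ℝ (Fin d))).translate c

lemma inv_sqrt_revolutionWeight_ne_zero {n : ℕ} {α β : ℝ} (hα : 0 < α) (hβ : 0 < β)
    (i : Fin (n + 1)) : (√(revolutionWeight n α β i))⁻¹ ≠ 0 := by
  have : 0 < revolutionWeight n α β i := by
    refine Fin.lastCases ?_ (fun j => ?_) i <;> simpa [revolutionWeight]
  positivity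

/-- The linear part of the ellipsoid `α |x|² + β t² ≤ 1`. -/
noncomputable def revolutionScaling (n : ℕ) {α β : ℝ} (hα : 0 < α) (hβ : 0 < β) :
    EuclideanSpace ℝ (Fin (n + 1)) ≃L[ℝ] EuclideanSpace ℝ (Fin (n + 1)) :=
  coordScaling (fun i => (√(revolutionWeight n α β i))⁻¹)
    (inv_sqrt_revolutionWeight_ne_zero hα hβ)

lemma det_revolutionScaling_sq (n : ℕ) {α β : ℝ} (hα : 0 < α) (hβ : 0 < β) :
    LinearMap.det (revolutionScaling n hα hβ :
      EuclideanSpace ℝ (Fin (n + 1)) →ₗ[ℝ] EuclideanSpace ℝ (Fin (n + 1))) ^ 2 =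
      (α ^ n * β)⁻¹ := by
  rw [revolutionScaling, det_coordScaling, ← Finset.prod_pow, ← prod_revolutionWeight,
    ← Finset.prod_inv_distrib]
  refine Finset.prod_congr rfl fun i _ => ?_
  have : 0 ≤ revolutionWeight n α β i := by
    refine Fin.lastCases ?_ (fun j => ?_) i <;> simpa [revolutionWeight] using le_of_lt ‹_›
  rw [inv_pow, Real.sq_sqrt this]

lemma norm_sq_revolutionScaling_symm {n : ℕ} {α β : ℝ} (hα : 0 < α) (hβ : 0 < β)
    (v : EuclideanSpace ℝ (Fin (n + 1))) :
    ‖(revolutionScaling n hα hβ).symm v‖ ^ 2 =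
      α * ∑ k : Fin n, v k.castSucc ^ 2 + β * v (Fin.last n) ^ 2 := by
  rw [EuclideanSpace.norm_sq_eq, Fin.sum_univ_castSucc, Finset.mul_sum]
  simp [revolutionScaling, coordScaling_symm_apply, revolutionWeight, mul_pow, Real.sq_sqrt,
    hα.le, hβ.le]

lemma bodyW2_subset_revolution {n : ℕ} (hn : 1 ≤ n) {α β c : ℝ} (hα : 0 < α) (hβ : 0 < β)
    (h0 : α * (n / Real.exp 1) ^ 2 + β * c ^ 2 ≤ 1) (h1 : α * n + β * (1 - c) ^ 2 ≤ 1) :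
    bodyW2 n ⊆ (fun x => c • lastBasisVector n + revolutionScaling n hα hβ x) ''
      Metric.closedBall 0 1 := by
  have hr := radius_pos hn
  have key : ∀ t (x : EuclideanSpace ℝ (Fin n)), α * ∑ k, x k ^ 2 + β * (t - c) ^ 2 ≤ 1 →
      atHeight t x ∈ (fun x => c • lastBasisVector n + revolutionScaling n hα hβ x) ''
      Metric.closedBall 0 1 := by
    intro t x h
    rw [mem_ellipsoid_iff, ← abs_of_nonneg (norm_nonneg _), ← sq_le_one_iff_abs_le_one,
      norm_sq_revolutionScaling_symm]
    simpa [lastBasisVector, atHeight_last, atHeight_castSucc] using h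
  refine convexHull_min ?_ (convex_ellipsoid _ _)
  rintro _ (⟨x, hx, rfl⟩ | ⟨x, hx, rfl⟩)
  · rw [mem_smul_octahedron hr] at hx
    refine key _ _ (le_trans ?_ h0)
    have : ∑ k, x k ^ 2 ≤ (n / Real.exp 1) ^ 2 := by
      calc ∑ k, x k ^ 2 = ∑ k, |x k| ^ 2 := by simp
        _ ≤ (∑ k, |x k|) ^ 2 := Finset.sum_sq_le_sq_sum_of_nonneg fun k _ => abs_nonneg _
        _ ≤ _ := pow_le_pow_left₀ (Finset.sum_nonneg fun k _ => abs_nonneg _) hx 2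
    have := mul_le_mul_of_nonneg_left this hα.le
    linarith
  · refine key _ _ (le_trans ?_ h1)
    have : ∑ k, x k ^ 2 ≤ n := by
      calc ∑ k, x k ^ 2 ≤ ∑ k : Fin n, (1 : ℝ) :=
            Finset.sum_le_sum fun k _ => (sq_le_one_iff_abs_le_one _).2 (hx k)
        _ = n := by simp
    have := mul_le_mul_of_nonneg_left this hα.le
    linarith

/-- `hαc` and `hβc` tune the determinant bound, while `h0` and `h1` place the body inside the
ellipsoid of revolution with the same α, β, c, which attains that bound. The bound is applied with M
= A⁻¹ and w = A⁻¹a; for a minimal ellipsoid its exponential factor must be at most 1, so the centre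
is determined. -/
lemma isLownerCenter_bodyW2_iff {n : ℕ} (hn : 1 ≤ n) {α β c : ℝ} (hc0 : 0 ≤ c) (hc1 : c ≤ 1)
    (hα : 0 < α) (hβ : 0 < β)
    (hαc : α * ((n + 1) * ((1 - c) * (n / Real.exp 1 ^ 2) + c)) = 1)
    (hβc : β * ((n + 1) * (c * (1 - c))) = 1)
    (h0 : α * (n / Real.exp 1) ^ 2 + β * c ^ 2 ≤ 1) (h1 : α * n + β * (1 - c) ^ 2 ≤ 1)
    (p : EuclideanSpace ℝ (Fin (n + 1))) :
    IsLownerCenter (bodyW2 n) p ↔ p = c • lastBasisVector n := by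
  have hsub := bodyW2_subset_revolution hn hα hβ h0 h1
  have hpos : 0 < α ^ n * β := by positivity
  have bound : ∀ (A : EuclideanSpace ℝ (Fin (n + 1)) ≃L[ℝ] EuclideanSpace ℝ (Fin (n + 1)))
      (a : EuclideanSpace ℝ (Fin (n + 1))),
      bodyW2 n ⊆ (fun x => a + A x) '' Metric.closedBall 0 1 →
      (α ^ n * β)⁻¹ * Real.exp ((n + 1) * ‖A.symm (a - c • lastBasisVector n)‖ ^ 2) ≤
        LinearMap.det (A : EuclideanSpace ℝ (Fin (n + 1)) →ₗ[ℝ] _) ^ 2 := by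
    intro A a hA
    have h := det_sq_le_of_bodyW2_subset hn
      (A.symm : EuclideanSpace ℝ (Fin (n + 1)) →ₗ[ℝ] EuclideanSpace ℝ (Fin (n + 1)))
      (A.symm a) (fun v hv => by
        have := (mem_ellipsoid_iff A a v).1 (hA hv)
        simpa using this) hc0 hc1 hα hβ hαc hβc
    have hdet : LinearMap.det (A.symm : EuclideanSpace ℝ (Fin (n + 1)) →ₗ[ℝ] _) *
        LinearMap.det (A : EuclideanSpace ℝ (Fin (n + 1)) →ₗ[ℝ] _) = 1 := by
      rw [← LinearMap.det_comp, ← LinearMap.det_id (M := EuclideanSpace ℝ (Fin (n + 1)))]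
      congr 1
      ext v
      simp
    set D := LinearMap.det (A : EuclideanSpace ℝ (Fin (n + 1)) →ₗ[ℝ] _)
    set D' := LinearMap.det (A.symm : EuclideanSpace ℝ (Fin (n + 1)) →ₗ[ℝ] _)
    have hdd : D' ^ 2 * D ^ 2 = 1 := by rw [← mul_pow, hdet, one_pow]
    have hm := mul_le_mul_of_nonneg_right h (sq_nonneg D)
    rw [hdd, Real.exp_neg] at hm
    have hw : (A.symm : EuclideanSpace ℝ (Fin (n + 1)) →ₗ[ℝ] EuclideanSpace ℝ (Fin (n + 1)))
        (lastBasisVector n) = A.symm (lastBasisVector n) := rfl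
    rw [hw] at hm
    rw [map_sub, map_smul]
    set X := Real.exp ((n + 1) * ‖A.symm a - c • A.symm (lastBasisVector n)‖ ^ 2) with hX
    have hXp : 0 < X := Real.exp_pos _
    rw [inv_mul_le_iff₀ hpos]
    calc X = X * 1 := (mul_one X).symm
      _ ≤ X * (α ^ n * β * X⁻¹ * D ^ 2) := mul_le_mul_of_nonneg_left hm hXp.le
      _ = _ := by field_simp
  have hopt : ∀ (A : EuclideanSpace ℝ (Fin (n + 1)) ≃L[ℝ] EuclideanSpace ℝ (Fin (n + 1)))
      (a : EuclideanSpace ℝ (Fin (n + 1))),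
      bodyW2 n ⊆ (fun x => a + A x) '' Metric.closedBall 0 1 →
      (α ^ n * β)⁻¹ ≤ LinearMap.det (A : EuclideanSpace ℝ (Fin (n + 1)) →ₗ[ℝ] _) ^ 2 := by
    intro A a hA
    refine le_trans ?_ (bound A a hA)
    exact le_mul_of_one_le_right (inv_nonneg.2 hpos.le) (Real.one_le_exp (by positivity))
  constructor
  · rintro ⟨_, ⟨A, rfl⟩, hA, hmin⟩
    have h := hmin _ _ ⟨_, rfl⟩ hsub
    rw [volume_ellipsoid_le_iff, det_revolutionScaling_sq] at h
    have h2 := (bound A p hA).trans h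
    have h3 : Real.exp ((n + 1) * ‖A.symm (p - c • lastBasisVector n)‖ ^ 2) ≤ 1 := by
      refine le_of_mul_le_mul_left (h2.trans_eq (mul_one _).symm) (inv_pos.2 hpos)
    rw [Real.exp_le_one_iff] at h3
    have h4 : ‖A.symm (p - c • lastBasisVector n)‖ ^ 2 ≤ 0 :=
      nonpos_of_mul_nonpos_right h3 (by positivity)
    have h5 : A.symm (p - c • lastBasisVector n) = 0 := by
      rw [← norm_eq_zero, ← sq_eq_zero_iff]
      exact le_antisymm h4 (sq_nonneg _)
    rw [map_eq_zero_iff _ A.symm.injective, sub_eq_zero] at h5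
    exact h5
  · rintro rfl
    refine ⟨_, ⟨revolutionScaling n hα hβ, rfl⟩, hsub, ?_⟩
    rintro _ c' ⟨A, rfl⟩ hA
    rw [volume_ellipsoid_le_iff, det_revolutionScaling_sq]
    exact hopt A c' hA

/-! ### The Löwner centre: quadratic equation and asymptotics. -/

/-- The last coordinate of the center of the Löwner ellipsoid of `bodyW2 n`. -/
noncomputable def lownerHeight (n : ℕ) : ℝ :=
  2 / ((2 + (n + 1) * (1 - Real.exp 1 ^ 2 / n)) +
    √((2 + (n + 1) * (1 - Real.exp 1 ^ 2 / n)) ^ 2 - 4 * ((n + 2) * (1 - Real.exp 1 ^ 2 / n))))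

/-- The polynomial A x² - B x + 1 is 1 at 0 and negative at 1. The rationalised formula for its root
in (0, 1) remains valid for A ≤ 0, which occurs below for n < e². -/
lemma quadratic_small_root {A B : ℝ} (hA : A < B - 1) (hD : 0 < B ^ 2 - 4 * A) :
    0 < 2 / (B + √(B ^ 2 - 4 * A)) ∧ 2 / (B + √(B ^ 2 - 4 * A)) < 1 ∧
      A * (2 / (B + √(B ^ 2 - 4 * A))) ^ 2 - B * (2 / (B + √(B ^ 2 - 4 * A))) + 1 = 0 := by
  set R := √(B ^ 2 - 4 * A) with hR
  have hR0 : 0 < R := Real.sqrt_pos.2 hD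
  have hR2 : R ^ 2 = B ^ 2 - 4 * A := Real.sq_sqrt hD.le
  -- For B < 2, the hypothesis `hA` gives R² > (2 - B)².
  have h2 : 2 < B + R := by
    rcases le_or_gt 2 B with h | h
    · linarith
    · nlinarith
  have hpos : 0 < B + R := by linarith
  refine ⟨by positivity, (div_lt_one hpos).2 h2, ?_⟩
  field_simp
  nlinarith

lemma lownerHeight_spec {n : ℕ} (hn : 1 ≤ n) :
    0 < lownerHeight n ∧ lownerHeight n < 1 ∧
      (n + 2) * (1 - Real.exp 1 ^ 2 / n) * lownerHeight n ^ 2 -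
        (2 + (n + 1) * (1 - Real.exp 1 ^ 2 / n)) * lownerHeight n + 1 = 0 := by
  have hn0 : (0 : ℝ) < n := by exact_mod_cast hn
  have hρ : 0 < Real.exp 1 ^ 2 / n := by positivity
  unfold lownerHeight
  set s := 1 - Real.exp 1 ^ 2 / n with hs
  have hs1 : s < 1 := by linarith
  apply quadratic_small_root
  · nlinarith
  · have : (2 + (n + 1) * s) ^ 2 - 4 * ((n + 2) * s) = 4 * (1 - s) + ((n + 1) * s) ^ 2 := by ring
    rw [this]
    have : 0 < 1 - s := by linarith
    positivity

lemma isLownerCenter_bodyW2_iff_eq_lownerHeight {n : ℕ} (hn : 1 ≤ n)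
    (p : EuclideanSpace ℝ (Fin (n + 1))) :
    IsLownerCenter (bodyW2 n) p ↔ p = lownerHeight n • lastBasisVector n := by
  obtain ⟨hc0, hc1, hq⟩ := lownerHeight_spec hn
  set c := lownerHeight n
  have hn0 : (0 : ℝ) < n := by exact_mod_cast hn
  have he : (0 : ℝ) < Real.exp 1 := Real.exp_pos 1
  set κ : ℝ := n / Real.exp 1 ^ 2 with hκ
  have hκ0 : 0 < κ := by positivity
  have hs : Real.exp 1 ^ 2 / n = κ⁻¹ := by rw [hκ, inv_div]
  rw [hs] at hq
  have hc1' : 0 < 1 - c := by linarith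
  have hQ : 0 < (1 - c) * κ + c := by positivity
  have hq' : (n + 2) * (κ - 1) * c ^ 2 - (2 * κ + (n + 1) * (κ - 1)) * c + κ = 0 := by
    have : κ * ((n + 2) * (1 - κ⁻¹) * c ^ 2 - (2 + (n + 1) * (1 - κ⁻¹)) * c + 1) = 0 := by
      rw [hq, mul_zero]
    rw [← this]
    field_simp
  have hp : ((n : ℝ) / Real.exp 1) ^ 2 = n * κ := by rw [hκ]; ring
  -- With these α and β, (1 - c) times the left side of `h0` plus c times that of `h1` is
  -- identically 1. Hence both contact conditions hold with equality and reduce to the single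
  -- quadratic `hq'`.
  refine isLownerCenter_bodyW2_iff hn hc0.le hc1.le
    (α := ((n + 1) * ((1 - c) * κ + c))⁻¹) (β := ((n + 1) * (c * (1 - c)))⁻¹)
    (by positivity) (by positivity) (inv_mul_cancel₀ (by positivity))
    (inv_mul_cancel₀ (by positivity)) (le_of_eq ?_) (le_of_eq ?_) p
  · rw [hp]
    field_simp
    linear_combination (-1) * hq'
  · field_simp
    linear_combination hq'

/-- Multiplying by n divides the denominator B + √(B² - 4A) by n. Since B/n → 1 and A/n² → 0, the
limit is 2/(1 + 1). -/
lemma tendsto_mul_lownerHeight :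
    Filter.Tendsto (fun n : ℕ => (n : ℝ) * lownerHeight n) Filter.atTop (nhds 1) := by
  have h1 : Filter.Tendsto (fun n : ℕ => 1 / (n : ℝ)) Filter.atTop (nhds 0) :=
    tendsto_one_div_atTop_nhds_zero_nat
  have hB : Filter.Tendsto (fun n : ℕ => 2 * (1 / (n : ℝ)) + (1 + 1 / (n : ℝ)) *
      (1 - Real.exp 1 ^ 2 * (1 / (n : ℝ)))) Filter.atTop
      (nhds (2 * 0 + (1 + 0) * (1 - Real.exp 1 ^ 2 * 0))) :=
    (h1.const_mul 2).add ((h1.const_add 1).mul ((h1.const_mul _).const_sub 1))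
  have hA : Filter.Tendsto (fun n : ℕ => (1 / (n : ℝ)) * ((1 + 2 * (1 / (n : ℝ))) *
      (1 - Real.exp 1 ^ 2 * (1 / (n : ℝ))))) Filter.atTop
      (nhds (0 * ((1 + 2 * 0) * (1 - Real.exp 1 ^ 2 * 0)))) :=
    h1.mul (((h1.const_mul 2).const_add 1).mul ((h1.const_mul _).const_sub 1))
  have hR := (tendsto_const_nhds (x := (2 : ℝ))).div
    (hB.add ((hB.pow 2).sub (hA.const_mul 4)).sqrt) (by norm_num)
  have hlim : (2 : ℝ) / (2 * 0 + (1 + 0) * (1 - Real.exp 1 ^ 2 * 0) +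
      √((2 * 0 + (1 + 0) * (1 - Real.exp 1 ^ 2 * 0)) ^ 2 -
        4 * (0 * ((1 + 2 * 0) * (1 - Real.exp 1 ^ 2 * 0))))) = 1 := by norm_num
  rw [hlim] at hR
  refine hR.congr' ?_
  filter_upwards [Filter.eventually_ge_atTop 1] with n hn
  have hn0 : (0 : ℝ) < n := by exact_mod_cast hn
  unfold lownerHeight
  set B : ℝ := 2 + (n + 1) * (1 - Real.exp 1 ^ 2 / n) with hBd
  set A : ℝ := (n + 2) * (1 - Real.exp 1 ^ 2 / n) with hAd
  have e1 : 2 * (1 / (n : ℝ)) + (1 + 1 / (n : ℝ)) * (1 - Real.exp 1 ^ 2 * (1 / (n : ℝ))) =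
      B / n := by rw [hBd]; field_simp
  have e2 : (1 / (n : ℝ)) * ((1 + 2 * (1 / (n : ℝ))) * (1 - Real.exp 1 ^ 2 * (1 / (n : ℝ)))) =
      A / n ^ 2 := by rw [hAd]; field_simp
  have e3 : (B / n) ^ 2 - 4 * (A / n ^ 2) = (B ^ 2 - 4 * A) / (n : ℝ) ^ 2 := by ring
  rw [Pi.div_apply, e1, e2, e3, Real.sqrt_div' _ (sq_nonneg _), Real.sqrt_sq hn0.le, ← add_div,
    div_div_eq_mul_div]
  ring

lemma isLittleO_sub_one_div_of_tendsto {u : ℕ → ℝ} {a b : ℝ}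
    (h : Filter.Tendsto (fun n : ℕ => (n : ℝ) * (u n - a)) Filter.atTop (nhds b)) :
    (fun n : ℕ => u n - (a + 1 / (n : ℝ) * b)) =o[Filter.atTop] (fun n : ℕ => 1 / (n : ℝ)) := by
  rw [Asymptotics.isLittleO_iff_tendsto']
  · refine Filter.Tendsto.congr' ?_ (sub_self b ▸ h.sub_const b)
    filter_upwards [Filter.eventually_ge_atTop 1] with n hn
    have hn0 : (0 : ℝ) < n := by exact_mod_cast hn
    field_simp
    ring
  · filter_upwards [Filter.eventually_ge_atTop 1] with n hn h0
    have hn0 : (0 : ℝ) < n := by exact_mod_cast hn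
    exact absurd h0 (by positivity)

/-! ### Volumes of the horizontal slices. -/

/-- The Minkowski sum of `a B₁` and `b B_∞`. -/
def crossCubeSum (n : ℕ) (a b : ℝ) : Set (Fin n → ℝ) :=
  {x | ∑ k, max (|x k| - b) 0 ≤ a}

/-- The volume of `crossCubeSum n a b`, for `a, b ≥ 0`. -/
noncomputable def crossCubePoly (n : ℕ) (a b : ℝ) : ℝ :=
  2 ^ n * ∑ k ∈ Finset.range (n + 1), (n.choose k : ℝ) * b ^ (n - k) * (a ^ k / k.factorial)

lemma continuous_crossCubePoly (n : ℕ) (b : ℝ) : Continuous fun a => crossCubePoly n a b := by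
  unfold crossCubePoly; fun_prop

lemma crossCubePoly_nonneg (n : ℕ) {a b : ℝ} (ha : 0 ≤ a) (hb : 0 ≤ b) :
    0 ≤ crossCubePoly n a b := by
  unfold crossCubePoly
  exact mul_nonneg (by positivity) (Finset.sum_nonneg fun k _ => by positivity)

lemma integral_crossCubePoly (n : ℕ) (a b : ℝ) :
    ∫ s in (0 : ℝ)..a, crossCubePoly n s b =
      2 ^ n * ∑ k ∈ Finset.range (n + 1), (n.choose k : ℝ) * b ^ (n - k) *
        (a ^ (k + 1) / (k + 1).factorial) := by
  unfold crossCubePoly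
  rw [intervalIntegral.integral_const_mul, intervalIntegral.integral_finsetSum
    (fun k _ => Continuous.intervalIntegrable (by fun_prop) _ _)]
  congr 1
  refine Finset.sum_congr rfl fun k _ => ?_
  rw [intervalIntegral.integral_const_mul, intervalIntegral.integral_div, integral_pow,
    Nat.factorial_succ]
  push_cast
  field_simp
  simp

/-- Pascal's rule, put in the form that Fubini produces in `integral_comp_excess`. -/
lemma crossCubePoly_succ (n : ℕ) (a b : ℝ) :
    crossCubePoly (n + 1) a b =
      2 * (b * crossCubePoly n a b + ∫ s in (0 : ℝ)..a, crossCubePoly n s b) := by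
  rw [integral_crossCubePoly]
  have hb : b * crossCubePoly n a b = 2 ^ n * (b ^ (n + 1) + ∑ k ∈ Finset.range (n + 1),
      (n.choose (k + 1) : ℝ) * b ^ (n - k) * (a ^ (k + 1) / (k + 1).factorial)) := by
    unfold crossCubePoly
    rw [mul_left_comm, Finset.sum_range_succ', Finset.sum_range_succ (n := n), Nat.choose_succ_self,
      mul_add, Finset.mul_sum]
    simp only [Nat.cast_zero, zero_mul, add_zero]
    rw [add_comm]
    congr 2
    · simp [pow_succ']
    · refine Finset.sum_congr rfl fun k hk => ?_
      have : n - k = (n - (k + 1)) + 1 := by have := Finset.mem_range.1 hk; omega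
      rw [this, pow_succ]
      ring
  rw [hb]
  unfold crossCubePoly
  rw [Finset.sum_range_succ', pow_succ]
  have : ∑ k ∈ Finset.range (n + 1), ((n + 1).choose (k + 1) : ℝ) * b ^ (n + 1 - (k + 1)) *
      (a ^ (k + 1) / (k + 1).factorial) =
      ∑ k ∈ Finset.range (n + 1), (n.choose k : ℝ) * b ^ (n - k) *
        (a ^ (k + 1) / (k + 1).factorial) +
      ∑ k ∈ Finset.range (n + 1), (n.choose (k + 1) : ℝ) * b ^ (n - k) *
        (a ^ (k + 1) / (k + 1).factorial) := by
    rw [← Finset.sum_add_distrib]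
    refine Finset.sum_congr rfl fun k _ => ?_
    rw [Nat.choose_succ_succ, Nat.add_sub_add_right]
    push_cast
    ring
  rw [this]
  simp
  ring

lemma isClosed_crossCubeSum (n : ℕ) (a b : ℝ) : IsClosed (crossCubeSum n a b) :=
  isClosed_le (f := fun x : Fin n → ℝ => ∑ k, max (|x k| - b) 0) (by fun_prop) (by fun_prop)

/-- On |y| ≤ b the integrand is constantly f a; each of the two flanks contributes the integral of f
over [0, a]. -/
lemma integral_comp_excess {f : ℝ → ℝ} (hf : Continuous f) {a b : ℝ} (ha : 0 ≤ a) (hb : 0 ≤ b) :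
    ∫ y in (-(a + b))..(a + b), f (a - max (|y| - b) 0) =
      2 * (b * f a + ∫ s in (0 : ℝ)..a, f s) := by
  have hc : ∀ u v, IntervalIntegrable (fun y => f (a - max (|y| - b) 0)) MeasureTheory.volume u v :=
    fun u v => Continuous.intervalIntegrable (by fun_prop) _ _
  have h1 : ∫ y in (-(a + b))..(-b), f (a - max (|y| - b) 0) = ∫ s in (0 : ℝ)..a, f s := by
    have : ∫ y in (-(a + b))..(-b), f (a - max (|y| - b) 0) =
        ∫ y in (-(a + b))..(-b), f (y + (a + b)) := by
      refine intervalIntegral.integral_congr fun y hy => ?_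
      rw [Set.uIcc_of_le (by linarith)] at hy
      have h0 : y ≤ -b := hy.2
      rw [abs_of_nonpos (by linarith), max_eq_left (by linarith)]
      congr 1; ring
    rw [this, intervalIntegral.integral_comp_add_right]
    congr 1 <;> ring
  have h2 : ∫ y in (-b)..b, f (a - max (|y| - b) 0) = 2 * (b * f a) := by
    have : ∫ y in (-b)..b, f (a - max (|y| - b) 0) = ∫ y in (-b)..b, f a := by
      refine intervalIntegral.integral_congr fun y hy => ?_
      rw [Set.uIcc_of_le (by linarith)] at hy
      have h0 : |y| ≤ b := abs_le.2 hy
      rw [max_eq_right (by linarith), sub_zero]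
    rw [this, intervalIntegral.integral_const, smul_eq_mul]
    ring
  have h3 : ∫ y in b..(a + b), f (a - max (|y| - b) 0) = ∫ s in (0 : ℝ)..a, f s := by
    have : ∫ y in b..(a + b), f (a - max (|y| - b) 0) = ∫ y in b..(a + b), f ((a + b) - y) := by
      refine intervalIntegral.integral_congr fun y hy => ?_
      rw [Set.uIcc_of_le (by linarith)] at hy
      have h0 : b ≤ y := hy.1
      rw [abs_of_nonneg (by linarith), max_eq_left (by linarith)]
      congr 1; ring
    rw [this, intervalIntegral.integral_comp_sub_left]
    congr 1 <;> ring
  rw [← intervalIntegral.integral_add_adjacent_intervals (hc _ (-b)) (hc _ _),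
    ← intervalIntegral.integral_add_adjacent_intervals (hc (-b) b) (hc _ _), h1, h2, h3]
  ring

/-- Induction by slicing along the first coordinate y, which uses up max(|y| - b, 0) of the budget
a. Negative budgets are included because slices with |y| > a + b have them and are empty. -/
lemma volume_crossCubeSum (n : ℕ) {b : ℝ} (hb : 0 ≤ b) (a : ℝ) :
    MeasureTheory.volume (crossCubeSum n a b) =
      if 0 ≤ a then ENNReal.ofReal (crossCubePoly n a b) else 0 := by
  induction n generalizing a with
  | zero =>
    split_ifs with h
    · have : crossCubeSum 0 a b = Set.univ := by ext x; simp [crossCubeSum, h]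
      rw [this]
      simp [crossCubePoly, MeasureTheory.volume_pi]
    · have : crossCubeSum 0 a b = ∅ := by ext x; simpa [crossCubeSum] using h
      rw [this, MeasureTheory.measure_empty]
  | succ n ih =>
    split_ifs with h
    swap
    · have : crossCubeSum (n + 1) a b = ∅ := by
        ext x
        simp only [crossCubeSum, Set.mem_ofPred_eq, Set.mem_empty_iff_false, iff_false, not_le]
        exact (not_le.1 h).trans_le (Finset.sum_nonneg fun k _ => le_max_right _ _)
      rw [this, MeasureTheory.measure_empty]
    let S : Set (ℝ × (Fin n → ℝ)) :=
      {q | max (|q.1| - b) 0 + ∑ k, max (|q.2 k| - b) 0 ≤ a}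
    have hS : MeasurableSet S :=
      (isClosed_le (f := fun q : ℝ × (Fin n → ℝ) =>
        max (|q.1| - b) 0 + ∑ k, max (|q.2 k| - b) 0) (by fun_prop) (by fun_prop)).measurableSet
    have hpre : crossCubeSum (n + 1) a b =
        (MeasurableEquiv.piFinSuccAbove (fun _ : Fin (n + 1) => ℝ) 0) ⁻¹' S := by
      ext x
      simp [crossCubeSum, S, Fin.sum_univ_succ, MeasurableEquiv.piFinSuccAbove, Fin.insertNthEquiv,
        Fin.tail]
    rw [hpre, (MeasureTheory.volume_preserving_piFinSuccAbove (fun _ : Fin (n + 1) => ℝ)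
      0).measure_preimage hS.nullMeasurableSet, MeasureTheory.Measure.volume_eq_prod,
      MeasureTheory.Measure.prod_apply hS]
    have hslice : ∀ y : ℝ, MeasureTheory.volume (Prod.mk y ⁻¹' S) =
        (Set.Icc (-(a + b)) (a + b)).indicator
          (fun y => ENNReal.ofReal (crossCubePoly n (a - max (|y| - b) 0) b)) y := by
      intro y
      have : Prod.mk y ⁻¹' S = crossCubeSum n (a - max (|y| - b) 0) b := by
        ext x
        simp only [S, crossCubeSum, Set.mem_preimage, Set.mem_ofPred_eq]
        rw [le_sub_iff_add_le']
      rw [this, ih, Set.indicator_apply]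
      have hiff : 0 ≤ a - max (|y| - b) 0 ↔ y ∈ Set.Icc (-(a + b)) (a + b) := by
        rw [sub_nonneg, max_le_iff, Set.mem_Icc, ← abs_le, tsub_le_iff_right]
        exact and_iff_left h
      simp only [hiff]
    simp_rw [hslice]
    have hcont : Continuous fun y => crossCubePoly n (a - max (|y| - b) 0) b :=
      (continuous_crossCubePoly n b).comp (by fun_prop)
    rw [MeasureTheory.lintegral_indicator measurableSet_Icc,
      ← MeasureTheory.ofReal_integral_eq_lintegral_ofReal
        (hcont.continuousOn.integrableOn_compact isCompact_Icc),
      MeasureTheory.integral_Icc_eq_integral_Ioc, ← intervalIntegral.integral_of_le (by linarith),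
      integral_comp_excess (continuous_crossCubePoly n b) h hb, crossCubePoly_succ]
    filter_upwards [MeasureTheory.ae_restrict_mem measurableSet_Icc] with y hy
    refine crossCubePoly_nonneg n ?_ hb
    rw [sub_nonneg, max_le_iff, tsub_le_iff_right]
    exact ⟨abs_le.2 hy, h⟩

/-! ### Moments of the slice volumes. -/

lemma integral_pow_mul_one_sub_pow (a b : ℕ) :
    ∫ t in (0 : ℝ)..1, t ^ a * (1 - t) ^ b =
      (a.factorial * b.factorial : ℝ) / (a + b + 1).factorial := by
  induction b generalizing a with
  | zero =>
    have : ((a : ℝ) + 1) ≠ 0 := by positivity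
    simp [integral_pow, Nat.factorial_succ]
    field_simp
  | succ b ih =>
    -- Integration by parts: this primitive vanishes at 0 and 1, so a factor 1 - t is traded for a
    -- factor t.
    have hd : ∀ t : ℝ, HasDerivAt (fun t : ℝ => t ^ (a + 1) * (1 - t) ^ (b + 1))
        ((a + 1) * (t ^ a * (1 - t) ^ (b + 1)) - (b + 1) * (t ^ (a + 1) * (1 - t) ^ b)) t := by
      intro t
      have h1 := hasDerivAt_pow (a + 1) t
      have h2 := ((hasDerivAt_id t).const_sub 1).pow (b + 1)
      convert! h1.mul h2 using 1
      simp only [Nat.add_sub_cancel, id, Pi.pow_apply]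
      push_cast
      ring
    have hI : ∀ p q : ℕ, IntervalIntegrable (fun t : ℝ => t ^ p * (1 - t) ^ q)
        MeasureTheory.volume 0 1 := fun p q => Continuous.intervalIntegrable (by fun_prop) _ _
    have h := intervalIntegral.integral_eq_sub_of_hasDerivAt (a := 0) (b := 1) (fun t _ => hd t)
      (((hI a (b + 1)).const_mul _).sub ((hI (a + 1) b).const_mul _))
    rw [intervalIntegral.integral_sub ((hI a (b + 1)).const_mul _) ((hI (a + 1) b).const_mul _),
      intervalIntegral.integral_const_mul, intervalIntegral.integral_const_mul, ih] at h
    simp only [one_pow, sub_self, zero_pow (Nat.succ_ne_zero _), mul_zero, zero_mul] at h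
    have e : a + 1 + b + 1 = a + (b + 1) + 1 := by ring
    rw [e, Nat.factorial_succ a] at h
    rw [Nat.factorial_succ b]
    push_cast at h ⊢
    have h' : ((a : ℝ) + 1) * (∫ t in (0 : ℝ)..1, t ^ a * (1 - t) ^ (b + 1)) =
        (a + 1) * (a.factorial * ((b + 1) * b.factorial) / (a + (b + 1) + 1).factorial) := by
      rw [sub_eq_zero.1 h]
      ring
    exact mul_left_cancel₀ (by positivity) h'

/-- The moments of the slice volume function. -/
lemma integral_pow_mul_crossCubePoly (n m : ℕ) (r : ℝ) :
    ∫ t in (0 : ℝ)..1, t ^ m * crossCubePoly n (r * (1 - t)) t =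
      2 ^ n * ∑ k ∈ Finset.range (n + 1), (n.choose k : ℝ) * (r ^ k / k.factorial) *
        (((n - k + m).factorial * k.factorial : ℝ) / (n + m + 1).factorial) := by
  have : ∀ t : ℝ, t ^ m * crossCubePoly n (r * (1 - t)) t =
      2 ^ n * ∑ k ∈ Finset.range (n + 1), (n.choose k : ℝ) * (r ^ k / k.factorial) *
        (t ^ (n - k + m) * (1 - t) ^ k) := by
    intro t
    unfold crossCubePoly
    rw [mul_left_comm, Finset.mul_sum]
    congr 1
    refine Finset.sum_congr rfl fun k _ => ?_
    rw [mul_pow, pow_add]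
    ring
  simp_rw [this]
  rw [intervalIntegral.integral_const_mul, intervalIntegral.integral_finsetSum
    (fun k _ => Continuous.intervalIntegrable (by fun_prop) _ _)]
  congr 1
  refine Finset.sum_congr rfl fun k hk => ?_
  have : n - k + m + k + 1 = n + m + 1 := by have := Finset.mem_range.1 hk; omega
  rw [intervalIntegral.integral_const_mul, integral_pow_mul_one_sub_pow, this]

lemma integral_crossCubePoly_slices (n : ℕ) (r : ℝ) :
    ∫ t in (0 : ℝ)..1, crossCubePoly n (r * (1 - t)) t =
      2 ^ n / (n + 1) * ∑ k ∈ Finset.range (n + 1), r ^ k / k.factorial := by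
  have h := integral_pow_mul_crossCubePoly n 0 r
  simp only [pow_zero, one_mul, add_zero] at h
  rw [h, div_mul_eq_mul_div, mul_div_assoc, Finset.sum_div]
  congr 1
  refine Finset.sum_congr rfl fun k hk => ?_
  have hk' : k ≤ n := Nat.lt_succ_iff.1 (Finset.mem_range.1 hk)
  have hc : (n.choose k : ℝ) * k.factorial * (n - k).factorial = n.factorial := by
    exact_mod_cast Nat.choose_mul_factorial_mul_factorial hk'
  rw [Nat.factorial_succ]
  push_cast
  rw [← hc]
  have h1 : (n.choose k : ℝ) ≠ 0 := by exact_mod_cast (Nat.choose_pos hk').ne'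
  field_simp

lemma integral_mul_crossCubePoly_slices (n : ℕ) (r : ℝ) :
    ∫ t in (0 : ℝ)..1, t * crossCubePoly n (r * (1 - t)) t =
      2 ^ n / ((n + 1) * (n + 2)) *
        ((n + 1 - r) * ∑ k ∈ Finset.range (n + 1), r ^ k / k.factorial +
          r * (r ^ n / n.factorial)) := by
  have h := integral_pow_mul_crossCubePoly n 1 r
  simp only [pow_one] at h
  -- The Beta integrals leave the weight n + 1 - k on r^k/k!. An index shift handles the k part and
  -- loses only the top term.
  have hs : ∀ N : ℕ, ∑ k ∈ Finset.range (N + 1), (k : ℝ) * (r ^ k / k.factorial) =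
      r * ∑ k ∈ Finset.range (N + 1), r ^ k / k.factorial - r * (r ^ N / N.factorial) := by
    intro N
    rw [Finset.sum_range_succ', Finset.sum_range_succ _ N, mul_add, add_sub_cancel_right,
      Finset.mul_sum]
    simp only [Nat.cast_zero, zero_mul, add_zero]
    refine Finset.sum_congr rfl fun k _ => ?_
    rw [Nat.factorial_succ]
    push_cast
    field_simp
    ring
  have hsum : (n + 1 - r) * ∑ k ∈ Finset.range (n + 1), r ^ k / k.factorial +
      r * (r ^ n / n.factorial) =
      ∑ k ∈ Finset.range (n + 1), ((n : ℝ) + 1 - k) * (r ^ k / k.factorial) := by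
    simp only [sub_mul _ _ (r ^ _ / _)]
    rw [Finset.sum_sub_distrib, hs, ← Finset.mul_sum]
    ring
  rw [h, hsum, div_mul_eq_mul_div, mul_div_assoc, Finset.sum_div]
  congr 1
  refine Finset.sum_congr rfl fun k hk => ?_
  have hk' : k ≤ n := Nat.lt_succ_iff.1 (Finset.mem_range.1 hk)
  have hc : (n.choose k : ℝ) * k.factorial * (n - k).factorial = n.factorial := by
    exact_mod_cast Nat.choose_mul_factorial_mul_factorial hk'
  rw [Nat.factorial_succ (n - k), Nat.factorial_succ (n + 1), Nat.factorial_succ n]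
  push_cast [Nat.cast_sub hk']
  rw [← hc]
  have h1 : (n.choose k : ℝ) ≠ 0 := by exact_mod_cast (Nat.choose_pos hk').ne'
  field_simp
  ring

/-! ### Asymptotics and computation of the centroid. -/

/-- The last coordinate of the centroid of `bodyW2 n`. -/
noncomputable def centroidHeight (n : ℕ) : ℝ :=
  (n + 1 - n / Real.exp 1 + n / Real.exp 1 * ((n / Real.exp 1) ^ n / n.factorial) /
    ∑ k ∈ Finset.range (n + 1), (n / Real.exp 1) ^ k / k.factorial) / (n + 2)

lemma tendsto_mul_centroidHeight_sub :
    Filter.Tendsto (fun n : ℕ => (n : ℝ) * (centroidHeight n - (1 - 1 / Real.exp 1)))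
      Filter.atTop (nhds (-(1 - 2 / Real.exp 1))) := by
  have he : (0 : ℝ) < Real.exp 1 := Real.exp_pos 1
  set d : ℕ → ℝ := fun n => n / Real.exp 1 * ((n / Real.exp 1) ^ n / n.factorial) /
    ∑ k ∈ Finset.range (n + 1), (n / Real.exp 1) ^ k / k.factorial with hd
  have h1 : Filter.Tendsto (fun n : ℕ => 1 / (n : ℝ)) Filter.atTop (nhds 0) :=
    tendsto_one_div_atTop_nhds_zero_nat
  have hd0 : Filter.Tendsto d Filter.atTop (nhds 0) := by
    -- Stirling gives r^n/n! ≤ 1, and S is at least its quadratic term r²/2, present for n ≥ 2. So d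
    -- n ≤ 2/r = 2e/n.
    refine squeeze_zero' (g := fun n : ℕ => 2 * Real.exp 1 * (1 / (n : ℝ))) ?_ ?_ ?_
    · exact Filter.Eventually.of_forall fun n => div_nonneg (by positivity)
        (Finset.sum_nonneg fun k _ => by positivity)
    · filter_upwards [Filter.eventually_ge_atTop 2] with n hn
      have hn0 : (0 : ℝ) < n := by exact_mod_cast (by omega : 0 < n)
      have hfac : (n / Real.exp 1) ^ n / n.factorial ≤ 1 := by
        rw [div_le_one (by positivity)]
        refine le_trans ?_ (Stirling.le_factorial_stirling n)
        refine le_mul_of_one_le_left (by positivity) ?_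
        rw [Real.one_le_sqrt]
        have : (2 : ℝ) ≤ n := by exact_mod_cast hn
        nlinarith [Real.pi_gt_three]
      have hS : (n / Real.exp 1) ^ 2 / 2 ≤
          ∑ k ∈ Finset.range (n + 1), (n / Real.exp 1) ^ k / k.factorial := by
        have := Finset.single_le_sum (f := fun k => (n / Real.exp 1) ^ k / (k.factorial : ℝ))
          (s := Finset.range (n + 1)) (fun k _ => by positivity)
          (Finset.mem_range.2 (by omega : 2 < n + 1))
        simpa using this
      calc d n ≤ (n / Real.exp 1 * 1) / ((n / Real.exp 1) ^ 2 / 2) := by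
            exact div_le_div₀ (by positivity)
              (mul_le_mul_of_nonneg_left hfac (by positivity)) (by positivity) hS
        _ = _ := by field_simp
    · simpa using h1.const_mul (2 * Real.exp 1)
  -- For n ≥ 1, n(g_n - (1 - 1/e)) equals (-(1 - 2/e) + d n)/(1 + 2/n) exactly.
  have hlim := ((hd0.const_add (-(1 - 2 / Real.exp 1))).mul
    ((tendsto_const_nhds (x := (1 : ℝ))).div ((h1.const_mul 2).const_add 1) (by norm_num)))
  have e0 : (-(1 - 2 / Real.exp 1) + 0) * (1 / (1 + 2 * 0)) = -(1 - 2 / Real.exp 1) := by ring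
  rw [e0] at hlim
  refine hlim.congr' ?_
  filter_upwards [Filter.eventually_ge_atTop 1] with n hn
  have hn0 : (0 : ℝ) < n := by exact_mod_cast hn
  have : centroidHeight n = (n + 1 - n / Real.exp 1 + d n) / (n + 2) := rfl
  rw [this, Pi.div_apply]
  field_simp
  ring

lemma isSolidConvexBody_bodyW2 {n : ℕ} (hn : 1 ≤ n) : IsSolidConvexBody (bodyW2 n) := by
  have hr := radius_pos hn
  have hK := bodyW2_eq_cubeConeRegion hn
  set r := (n : ℝ) / Real.exp 1
  refine ⟨convex_convexHull ℝ _, ?_, ?_⟩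
  · have hcont : Continuous fun x : Fin (n + 1) → ℝ =>
        (WithLp.toLp 2 x : EuclideanSpace ℝ (Fin (n + 1))) := by fun_prop
    refine ((isCompact_Icc (a := fun _ : Fin (n + 1) => -(r + 1))
      (b := fun _ => r + 1)).image hcont).of_isClosed_subset
        (hK ▸ isClosed_cubeConeRegion n r) ?_
    rw [hK]
    rintro v ⟨h0, h1, hs⟩
    have hb : ∀ i, |v i| ≤ r + 1 := by
      intro i
      refine Fin.lastCases ?_ (fun j => ?_) i
      · rw [abs_of_nonneg h0]; linarith
      · have h2 := Finset.single_le_sum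
          (f := fun k : Fin n => max (|v k.castSucc| - v (Fin.last n)) 0)
          (fun k _ => le_max_right _ _) (Finset.mem_univ j)
        have h3 := le_max_left (|v j.castSucc| - v (Fin.last n)) 0
        have h4 : r * (1 - v (Fin.last n)) ≤ r := by nlinarith
        simp only at h2
        linarith
    exact ⟨fun i => v i, ⟨fun i => (abs_le.1 (hb i)).1, fun i => (abs_le.1 (hb i)).2⟩, rfl⟩
  · rw [hK]; exact interior_cubeConeRegion_nonempty n hr

/-- Separation of the last coordinate. -/
noncomputable def splitLast (n : ℕ) : EuclideanSpace ℝ (Fin (n + 1)) ≃ᵐ ℝ × (Fin n → ℝ) :=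
  (MeasurableEquiv.toLp 2 (Fin (n + 1) → ℝ)).symm.trans
    (MeasurableEquiv.piFinSuccAbove (fun _ : Fin (n + 1) => ℝ) (Fin.last n))

lemma splitLast_apply (n : ℕ) (v : EuclideanSpace ℝ (Fin (n + 1))) :
    splitLast n v = (v (Fin.last n), fun k => v k.castSucc) := by
  simp only [splitLast, MeasurableEquiv.trans_apply]
  ext k
  · rfl
  · simp [MeasurableEquiv.piFinSuccAbove, Fin.insertNthEquiv, Fin.init]

lemma measurePreserving_splitLast (n : ℕ) :
    MeasureTheory.MeasurePreserving (splitLast n) MeasureTheory.volume MeasureTheory.volume :=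
  (EuclideanSpace.volume_preserving_symm_measurableEquiv_toLp (Fin (n + 1))).trans
    (MeasureTheory.volume_preserving_piFinSuccAbove (fun _ : Fin (n + 1) => ℝ) (Fin.last n))

/-- Fubini along the last coordinate; f = 1 gives the volume and f(t) = t the first moment. -/
lemma setIntegral_bodyW2 {n : ℕ} (hn : 1 ≤ n) {f : ℝ → ℝ} (hf : Continuous f) :
    ∫ v in bodyW2 n, f (v (Fin.last n)) =
      ∫ t in (0 : ℝ)..1, f t * crossCubePoly n (n / Real.exp 1 * (1 - t)) t := by
  have hr := radius_pos hn
  have hK := bodyW2_eq_cubeConeRegion hn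
  have hint : MeasureTheory.IntegrableOn (fun v : EuclideanSpace ℝ (Fin (n + 1)) =>
      f (v (Fin.last n))) (bodyW2 n) :=
    ContinuousOn.integrableOn_compact (isSolidConvexBody_bodyW2 hn).2.1 (by fun_prop)
  set r := (n : ℝ) / Real.exp 1
  let S : Set (ℝ × (Fin n → ℝ)) :=
    {q | q.1 ∈ Set.Icc 0 1 ∧ q.2 ∈ crossCubeSum n (r * (1 - q.1)) q.1}
  have hS : MeasurableSet S := by
    have h1 : IsClosed {q : ℝ × (Fin n → ℝ) | q.1 ∈ Set.Icc (0 : ℝ) 1} :=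
      isClosed_Icc.preimage continuous_fst
    have h2 : IsClosed {q : ℝ × (Fin n → ℝ) | ∑ k, max (|q.2 k| - q.1) 0 ≤ r * (1 - q.1)} :=
      isClosed_le (by fun_prop) (by fun_prop)
    exact (h1.inter h2).measurableSet
  have hpre : bodyW2 n = splitLast n ⁻¹' S := by
    rw [hK]
    ext v
    simp [S, splitLast_apply, cubeConeRegion, crossCubeSum, and_assoc]
  have hcomp : (fun v : EuclideanSpace ℝ (Fin (n + 1)) => f (v (Fin.last n))) =
      (fun q : ℝ × (Fin n → ℝ) => f q.1) ∘ splitLast n := by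
    ext v; simp [splitLast_apply]
  have hemb := (splitLast n).measurableEmbedding
  rw [hcomp, hpre, (measurePreserving_splitLast n).integrableOn_comp_preimage hemb] at hint
  rw [hpre, hcomp]
  rw [show (∫ v in splitLast n ⁻¹' S, ((fun q : ℝ × (Fin n → ℝ) => f q.1) ∘ splitLast n) v) =
    ∫ v in splitLast n ⁻¹' S, f (splitLast n v).1 from rfl,
    (measurePreserving_splitLast n).setIntegral_preimage_emb hemb (fun q => f q.1) S,
    ← MeasureTheory.integral_indicator hS, MeasureTheory.Measure.volume_eq_prod,
    MeasureTheory.integral_prod _ ((MeasureTheory.integrable_indicator_iff hS).2 hint),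
    intervalIntegral.integral_of_le zero_le_one, ← MeasureTheory.integral_Icc_eq_integral_Ioc,
    ← MeasureTheory.integral_indicator measurableSet_Icc]
  refine MeasureTheory.integral_congr_ae (Filter.Eventually.of_forall fun t => ?_)
  by_cases ht : t ∈ Set.Icc (0 : ℝ) 1
  · have ha : 0 ≤ r * (1 - t) := mul_nonneg hr.le (sub_nonneg.2 ht.2)
    have hi : (fun x : Fin n → ℝ => S.indicator (fun q => f q.1) (t, x)) =
        (crossCubeSum n (r * (1 - t)) t).indicator (fun _ => f t) := by
      ext x
      by_cases hx : x ∈ crossCubeSum n (r * (1 - t)) t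
      · rw [Set.indicator_of_mem hx, Set.indicator_of_mem (show (t, x) ∈ S from ⟨ht, hx⟩)]
      · rw [Set.indicator_of_notMem hx, Set.indicator_of_notMem fun h : (t, x) ∈ S => hx h.2]
    simp only [Set.indicator_of_mem ht, hi]
    rw [MeasureTheory.integral_indicator (isClosed_crossCubeSum n _ _).measurableSet,
      MeasureTheory.setIntegral_const, MeasureTheory.measureReal_def, volume_crossCubeSum n ht.1,
      if_pos ha, ENNReal.toReal_ofReal (crossCubePoly_nonneg n ha ht.1), smul_eq_mul, mul_comm]
  · have hi : (fun x : Fin n → ℝ => S.indicator (fun q => f q.1) (t, x)) = fun _ => 0 := by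
      ext x
      exact Set.indicator_of_notMem (fun h : (t, x) ∈ S => ht h.1) _
    simp only [Set.indicator_of_notMem ht, hi, MeasureTheory.integral_zero]

/-- The reflection in a coordinate hyperplane. -/
noncomputable def coordReflection {d : ℕ} (j : Fin d) :
    EuclideanSpace ℝ (Fin d) ≃ₗᵢ[ℝ] EuclideanSpace ℝ (Fin d) :=
  LinearIsometryEquiv.piLpCongrRight 2 fun i =>
    if i = j then LinearIsometryEquiv.neg ℝ else LinearIsometryEquiv.refl ℝ ℝ

lemma coordReflection_apply {d : ℕ} (j i : Fin d) (v : EuclideanSpace ℝ (Fin d)) :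
    coordReflection j v i = if i = j then -v i else v i := by
  simp only [coordReflection, LinearIsometryEquiv.piLpCongrRight_apply]
  split_ifs <;> simp

lemma setIntegral_bodyW2_castSucc {n : ℕ} (hn : 1 ≤ n) (j : Fin n) :
    ∫ v in bodyW2 n, v j.castSucc = 0 := by
  -- The body is symmetric in this coordinate, so the integral equals its own negative.
  have hpre : coordReflection j.castSucc ⁻¹' bodyW2 n = bodyW2 n := by
    rw [bodyW2_eq_cubeConeRegion hn]
    ext v
    have habs : ∀ i, |coordReflection j.castSucc v i| = |v i| := by
      intro i
      rw [coordReflection_apply]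
      split_ifs <;> simp
    have hl : coordReflection j.castSucc v (Fin.last n) = v (Fin.last n) := by
      rw [coordReflection_apply, if_neg (Fin.castSucc_lt_last j).ne']
    simp only [Set.mem_preimage, cubeConeRegion, Set.mem_ofPred_eq, habs, hl]
  have h := (coordReflection j.castSucc).measurePreserving.setIntegral_preimage_emb
    (coordReflection j.castSucc).toHomeomorph.measurableEmbedding
    (fun v : EuclideanSpace ℝ (Fin (n + 1)) => v j.castSucc) (bodyW2 n)
  rw [hpre] at h
  simp only [coordReflection_apply, if_true, MeasureTheory.integral_neg] at h
  linarith

lemma bodyCentroid_bodyW2 {n : ℕ} (hn : 1 ≤ n) :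
    bodyCentroid (bodyW2 n) = centroidHeight n • lastBasisVector n := by
  have hr := radius_pos hn
  have hint : MeasureTheory.IntegrableOn (fun v : EuclideanSpace ℝ (Fin (n + 1)) => v)
      (bodyW2 n) := ContinuousOn.integrableOn_compact
        (isSolidConvexBody_bodyW2 hn).2.1 (by fun_prop)
  have hcoord : ∀ i, (∫ v in bodyW2 n, v) i = ∫ v in bodyW2 n, v i := fun i =>
    ((EuclideanSpace.proj i : EuclideanSpace ℝ (Fin (n + 1)) →L[ℝ] ℝ).integral_comp_comm hint).symm
  have hvol : MeasureTheory.volume.real (bodyW2 n) =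
      2 ^ n / (n + 1) * ∑ k ∈ Finset.range (n + 1), (n / Real.exp 1) ^ k / k.factorial := by
    have h := setIntegral_bodyW2 hn (f := fun _ => 1) continuous_const
    simp only [one_mul, integral_crossCubePoly_slices] at h
    rw [← h]
    simp
  have hlast : ∫ v in bodyW2 n, v (Fin.last n) = 2 ^ n / ((n + 1) * (n + 2)) *
        ((n + 1 - n / Real.exp 1) * ∑ k ∈ Finset.range (n + 1), (n / Real.exp 1) ^ k / k.factorial +
          n / Real.exp 1 * ((n / Real.exp 1) ^ n / n.factorial)) := by
    rw [← integral_mul_crossCubePoly_slices]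
    exact setIntegral_bodyW2 hn (f := fun t => t) continuous_id
  have hS : 0 < ∑ k ∈ Finset.range (n + 1), (n / Real.exp 1) ^ k / (k.factorial : ℝ) :=
    Finset.sum_pos (fun k _ => by positivity) ⟨0, by simp⟩
  ext i
  rw [bodyCentroid, PiLp.smul_apply, PiLp.smul_apply, hcoord]
  refine Fin.lastCases ?_ (fun j => ?_) i
  · rw [hlast, hvol, centroidHeight, lastBasisVector]
    simp only [smul_eq_mul, PiLp.single_apply, if_true, mul_one]
    set S := ∑ k ∈ Finset.range (n + 1), (n / Real.exp 1) ^ k / (k.factorial : ℝ)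
    set q := (n / Real.exp 1) ^ n / (n.factorial : ℝ)
    set r := (n : ℝ) / Real.exp 1
    field_simp
  · rw [setIntegral_bodyW2_castSucc hn]
    simp [lastBasisVector]

theorem mainTheorem8 :
    (∀ n : ℕ, 1 ≤ n → IsSolidConvexBody (bodyW2 n)) ∧
    (∃ l : ℕ → ℝ,
      (∀ n : ℕ, 1 ≤ n → ∀ p : EuclideanSpace ℝ (Fin (n + 1)),
        IsLownerCenter (bodyW2 n) p ↔ p = l n • lastBasisVector n) ∧
      (fun n : ℕ => l n - 1 / (n : ℝ)) =o[Filter.atTop] (fun n : ℕ => 1 / (n : ℝ))) ∧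
    (∃ g : ℕ → ℝ,
      (∀ n : ℕ, 1 ≤ n → bodyCentroid (bodyW2 n) = g n • lastBasisVector n) ∧
      (fun n : ℕ => g n -
          (1 - 1 / Real.exp 1 - 1 / (n : ℝ) * (1 - 2 / Real.exp 1)))
        =o[Filter.atTop] (fun n : ℕ => 1 / (n : ℝ))) := by
  refine ⟨fun n hn => isSolidConvexBody_bodyW2 hn,
    ⟨lownerHeight, fun n hn p => isLownerCenter_bodyW2_iff_eq_lownerHeight hn p, ?_⟩,
    ⟨centroidHeight, fun n hn => bodyCentroid_bodyW2 hn, ?_⟩⟩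
  · have h := isLittleO_sub_one_div_of_tendsto (u := lownerHeight) (a := 0) (b := 1)
      (by simpa using tendsto_mul_lownerHeight)
    simpa using h
  · refine (isLittleO_sub_one_div_of_tendsto tendsto_mul_centroidHeight_sub).congr_left fun n => ?_
    ring
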